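/- For $n\ge 1$, let $\mathrm{vol}$ be Lebesgue measure on $\mathbf{R}^n$ and, for $x\in\mathbf{R}^n$ and $r>0$, let $Q(x,r)=\prod_{i=1}^n[x_i-r,\,x_i+r]$ be the cube with center $x$ and edge length $2r$. Let $\mu$ be the counting measure on the lattice $\mathbf{Z}^n$, i.e. $\mu(A)=\mathrm{card}(A\cap\mathbf{Z}^n)$ for every Borel set $A\subset\mathbf{R}^n$, and let \[ M\mu(x)=\sup_{r>0}\frac{\mu(Q(x,r))}{\mathrm{vol}(Q(x,r))}\in[0,\infty] \] be its centered cubic Hardy--Littlewood maximal function. Then for every real number $L>0$, \[ \lim_{n\to\infty}\mathrm{vol}\bigl(\{x\in[0,1]^n : M\mu(x)>L\}\bigr)=1 . \] -/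

import Mathlib

open MeasureTheory Filter Topology
open scoped ENNReal

/-- The (closed) cube `Q(x, r)` in `ℝⁿ` with center `x` and edge length `2 r`. -/
def cube {n : ℕ} (x : Fin n → ℝ) (r : ℝ) : Set (Fin n → ℝ) :=
  Set.Icc (fun i => x i - r) (fun i => x i + r)

/-- The cubic centered Hardy–Littlewood maximal function of a Borel measure `ν` on `ℝⁿ`:
`M ν (x) = sup_{r > 0} ν(Q(x, r)) / vol(Q(x, r))`, with values in `[0, ∞]`. -/
noncomputable def maximalFunction {n : ℕ} (ν : Measure (Fin n → ℝ)) (x : Fin n → ℝ) : ℝ≥0∞ :=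
  ⨆ (r : ℝ) (_ : 0 < r), ν (cube x r) / volume (cube x r)

/-- The measure on `ℝⁿ` with a Dirac mass on each point of the lattice `ℤⁿ`. -/
noncomputable def latticeMeasure (n : ℕ) : Measure (Fin n → ℝ) :=
  Measure.sum fun z : Fin n → ℤ => Measure.dirac fun i => (z i : ℝ)

/-! For `x` in the unit cube, a cube of edge `2N + p` contains `∏ (2N + 1)` or `2N` lattice points
per coordinate, with the extra point exactly when `x i` is within `p / 2` of an endpoint. Its
density is therefore at least a product of `n` independent factors `1 + a X` with `a = 1 / (2N + p)`
and `X` centered. With `N` of order `√n` this product has mean 1 and limiting second moment `exp s`;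
choosing `exp s = L + 1` makes `t ^ 2 - L t - 1` have limiting mean zero, while it is at most `-1`
wherever `0 ≤ t ≤ L`.

Offsets `p = θ ^ (j + 1)` with small `θ` give nearly uncorrelated test variables
(`abs_correlation_lt`). If all `m` products are at most `L`, the sum of the test variables is at
most `-m`, and Chebyshev makes this unlikely (`eventually_measure_forall_le_lt`). -/

/-- The product `∏ i, (1 + a X(x i))` of independent copies of `1 + a X`. -/
noncomputable def prodOneAdd {E : Type*} (X : E → ℝ) (a : ℝ) {n : ℕ} (x : Fin n → E) : ℝ :=
  ∏ i, (1 + a * X (x i))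

lemma one_add_pow_of_lt_three {k : ℕ} (hk : k < 3) (x : ℝ) :
    (1 + x) ^ k = 1 + k * x + (k.choose 2 : ℝ) * x ^ 2 := by
  interval_cases k
  · simp
  · simp
  · norm_num [Nat.choose]; ring

lemma tendsto_zero_of_sqrt_mul {a : ℕ → ℝ} {A : ℝ}
    (ha : Tendsto (fun n : ℕ => √n * a n) atTop (𝓝 A)) : Tendsto a atTop (𝓝 0) := by
  have h1 : Tendsto (fun n : ℕ => (√(n : ℝ))⁻¹) atTop (𝓝 0) :=
    tendsto_inv_atTop_zero.comp (Real.tendsto_sqrt_atTop.comp tendsto_natCast_atTop_atTop)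
  have h2 := h1.mul ha
  rw [zero_mul] at h2
  refine h2.congr' ?_
  filter_upwards [eventually_gt_atTop 0] with n hn
  have : √(n : ℝ) ≠ 0 := by positivity
  field_simp

/-! ### Limiting mixed moments of products of independent factors -/

section Moments

variable {E : Type*} [MeasurableSpace E] {U : Measure E} [IsProbabilityMeasure U]

lemma integrable_of_abs_le_one {f : E → ℝ} (hf : Measurable f) (h : ∀ x, |f x| ≤ 1) :
    Integrable f U :=
  Integrable.of_bound hf.aestronglyMeasurable 1 (ae_of_all _ h)

lemma integrable_pow_mul_pow {X Y : E → ℝ} (hX : Measurable X) (hY : Measurable Y)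
    (hX1 : ∀ x, |X x| ≤ 1) (hY1 : ∀ x, |Y x| ≤ 1) (i j : ℕ) :
    Integrable (fun x => X x ^ i * Y x ^ j) U := by
  refine integrable_of_abs_le_one ((hX.pow_const i).mul (hY.pow_const j)) fun x => ?_
  rw [abs_mul, abs_pow, abs_pow]
  exact mul_le_one₀ (pow_le_one₀ (abs_nonneg _) (hX1 x)) (by positivity)
    (pow_le_one₀ (abs_nonneg _) (hY1 x))

lemma integrable_one_add_pow_mul {X Y : E → ℝ} (hX : Measurable X) (hY : Measurable Y)
    (hX1 : ∀ x, |X x| ≤ 1) (hY1 : ∀ x, |Y x| ≤ 1) (a b : ℝ) (k l : ℕ) :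
    Integrable (fun x => (1 + a * X x) ^ k * (1 + b * Y x) ^ l) U := by
  refine Integrable.of_bound (C := (1 + |a|) ^ k * (1 + |b|) ^ l) ?_ (ae_of_all _ fun x => ?_)
  · exact (Measurable.mul (by fun_prop) (by fun_prop)).aestronglyMeasurable
  · have key : ∀ c y : ℝ, |y| ≤ 1 → |1 + c * y| ≤ 1 + |c| := fun c y hy => by
      refine (abs_add_le _ _).trans ?_
      rw [abs_one, abs_mul]
      nlinarith [abs_nonneg c]
    rw [Real.norm_eq_abs, abs_mul, abs_pow, abs_pow]
    gcongr
    · exact key _ _ (hX1 x)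
    · exact key _ _ (hY1 x)

/-- Centering kills the linear terms. The quadratic ones have size `1 / n` and survive; each higher
one carries an extra `a n` or `b n`, which tends to 0. -/
lemma tendsto_moment_sub_one {X Y : E → ℝ} (hX : Measurable X) (hY : Measurable Y)
    (hX1 : ∀ x, |X x| ≤ 1) (hY1 : ∀ x, |Y x| ≤ 1)
    (hX0 : ∫ x, X x ∂U = 0) (hY0 : ∫ x, Y x ∂U = 0) {a b : ℕ → ℝ} {A B : ℝ}
    (ha : Tendsto (fun n : ℕ => √n * a n) atTop (𝓝 A))
    (hb : Tendsto (fun n : ℕ => √n * b n) atTop (𝓝 B)) {k l : ℕ} (hk : k < 3) (hl : l < 3) :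
    Tendsto (fun n : ℕ => n * (∫ x, (1 + a n * X x) ^ k * (1 + b n * Y x) ^ l ∂U - 1)) atTop
      (𝓝 (k.choose 2 * (A ^ 2 * ∫ x, X x ^ 2 ∂U) + l.choose 2 * (B ^ 2 * ∫ x, Y x ^ 2 ∂U)
        + k * l * (A * B * ∫ x, X x * Y x ∂U))) := by
  set c : ℕ → ℕ → ℝ := fun i j => ∫ x, X x ^ i * Y x ^ j ∂U with hc
  have c00 : c 0 0 = 1 := by simp [hc]
  have c10 : c 1 0 = 0 := by simpa [hc] using hX0
  have c01 : c 0 1 = 0 := by simpa [hc] using hY0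
  have c20 : ∫ x, X x ^ 2 ∂U = c 2 0 := by simp [hc]
  have c02 : ∫ x, Y x ^ 2 ∂U = c 0 2 := by simp [hc]
  have c11 : ∫ x, X x * Y x ∂U = c 1 1 := by simp [hc]
  have expand : ∀ a b : ℝ, ∫ x, (1 + a * X x) ^ k * (1 + b * Y x) ^ l ∂U
      = ∑ i ∈ Finset.range 3, ∑ j ∈ Finset.range 3,
        ((k.choose i : ℝ) * a ^ i * ((l.choose j : ℝ) * b ^ j)) * c i j := by
    intro a b
    have h : ∀ x, (1 + a * X x) ^ k * (1 + b * Y x) ^ l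
        = ∑ i ∈ Finset.range 3, ∑ j ∈ Finset.range 3,
          ((k.choose i : ℝ) * a ^ i * ((l.choose j : ℝ) * b ^ j)) * (X x ^ i * Y x ^ j) := by
      intro x
      rw [one_add_pow_of_lt_three hk, one_add_pow_of_lt_three hl]
      simp [Finset.sum_range_succ]
      ring
    simp_rw [h]
    rw [integral_finsetSum _ fun i _ => integrable_finsetSum _ fun j _ =>
      (integrable_pow_mul_pow hX hY hX1 hY1 i j).const_mul _]
    refine Finset.sum_congr rfl fun i _ => ?_
    rw [integral_finsetSum _ fun j _ => (integrable_pow_mul_pow hX hY hX1 hY1 i j).const_mul _]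
    exact Finset.sum_congr rfl fun j _ => integral_const_mul _ _
  have ha0 := tendsto_zero_of_sqrt_mul ha
  have hb0 := tendsto_zero_of_sqrt_mul hb
  have key : ∀ n : ℕ, n * (∫ x, (1 + a n * X x) ^ k * (1 + b n * Y x) ^ l ∂U - 1)
      = k.choose 2 * ((√n * a n) ^ 2 * c 2 0) + l.choose 2 * ((√n * b n) ^ 2 * c 0 2)
        + k * l * ((√n * a n) * (√n * b n) * c 1 1)
        + (k * l.choose 2 * c 1 2) * ((√n * a n) * (√n * b n) * b n)
        + (k.choose 2 * l * c 2 1) * ((√n * a n) * (√n * b n) * a n)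
        + (k.choose 2 * l.choose 2 * c 2 2) * ((√n * a n) * (√n * b n) * (a n * b n)) := by
    intro n
    have hn : (n : ℝ) = √n ^ 2 := (Real.sq_sqrt n.cast_nonneg).symm
    rw [expand, hn]
    simp only [Finset.sum_range_succ, Finset.sum_range_zero, c00, c10, c01, Nat.choose_zero_right,
      Nat.choose_one_right, Nat.cast_one, Real.sqrt_sq (Real.sqrt_nonneg _)]
    ring
  simp_rw [key, c20, c02, c11]
  have hAB := ha.mul hb
  have := (((((((ha.pow 2).mul_const (c 2 0)).const_mul (k.choose 2 : ℝ)).add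
    (((hb.pow 2).mul_const (c 0 2)).const_mul (l.choose 2 : ℝ))).add
    ((hAB.mul_const (c 1 1)).const_mul (k * l : ℝ))).add
    ((hAB.mul hb0).const_mul (k * l.choose 2 * c 1 2))).add
    ((hAB.mul ha0).const_mul (k.choose 2 * l * c 2 1))).add
    ((hAB.mul (ha0.mul hb0)).const_mul (k.choose 2 * l.choose 2 * c 2 2))
  simpa using this

lemma prodOneAdd_pow_mul_pow {E : Type*} (X Y : E → ℝ) (a b : ℝ) (k l : ℕ) {n : ℕ} (x : Fin n → E) :
    prodOneAdd X a x ^ k * prodOneAdd Y b x ^ l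
      = ∏ i, ((1 + a * X (x i)) ^ k * (1 + b * Y (x i)) ^ l) := by
  simp [prodOneAdd, Finset.prod_mul_distrib, Finset.prod_pow]

lemma integrable_prodOneAdd {X Y : E → ℝ} (hX : Measurable X) (hY : Measurable Y)
    (hX1 : ∀ x, |X x| ≤ 1) (hY1 : ∀ x, |Y x| ≤ 1) (a b : ℝ) (k l n : ℕ) :
    Integrable (fun x => prodOneAdd X a x ^ k * prodOneAdd Y b x ^ l)
      (Measure.pi fun _ : Fin n => U) := by
  simp_rw [prodOneAdd_pow_mul_pow]
  exact Integrable.fintype_prod fun _ => integrable_one_add_pow_mul hX hY hX1 hY1 a b k l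

/-- By independence the integral is the `n`-th power of a one-coordinate moment `1 + O(1 / n)`. -/
lemma tendsto_integral_prodOneAdd {X Y : E → ℝ} (hX : Measurable X) (hY : Measurable Y)
    (hX1 : ∀ x, |X x| ≤ 1) (hY1 : ∀ x, |Y x| ≤ 1)
    (hX0 : ∫ x, X x ∂U = 0) (hY0 : ∫ x, Y x ∂U = 0) {a b : ℕ → ℝ} {A B : ℝ}
    (ha : Tendsto (fun n : ℕ => √n * a n) atTop (𝓝 A))
    (hb : Tendsto (fun n : ℕ => √n * b n) atTop (𝓝 B)) {k l : ℕ} (hk : k < 3) (hl : l < 3) :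
    Tendsto (fun n : ℕ => ∫ x, prodOneAdd X (a n) x ^ k * prodOneAdd Y (b n) x ^ l
        ∂(Measure.pi fun _ : Fin n => U)) atTop
      (𝓝 (Real.exp (k.choose 2 * (A ^ 2 * ∫ x, X x ^ 2 ∂U)
        + l.choose 2 * (B ^ 2 * ∫ x, Y x ^ 2 ∂U) + k * l * (A * B * ∫ x, X x * Y x ∂U)))) := by
  simp_rw [prodOneAdd_pow_mul_pow]
  have := Real.tendsto_one_add_pow_exp_of_tendsto
    (tendsto_moment_sub_one (U := U) hX hY hX1 hY1 hX0 hY0 ha hb hk hl)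
  refine this.congr fun n => ?_
  rw [integral_fintype_prod_eq_pow
    (fun x => (1 + a n * X x) ^ k * (1 + b n * Y x) ^ l), Fintype.card_fin]
  ring_nf

/-! ### The quadratic test polynomial and the second moment bound -/

/-- Coefficients of the quadratic test polynomial `t ^ 2 - L t - 1`. -/
noncomputable def testCoeff (L : ℝ) (k : ℕ) : ℝ :=
  if k = 0 then -1 else if k = 1 then -L else 1

/-- The test polynomial `t ^ 2 - L t - 1`, which is at most `-1` on `[0, L]`. -/
noncomputable def testPoly (L t : ℝ) : ℝ := ∑ k ∈ Finset.range 3, testCoeff L k * t ^ k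

/-- The limiting second moment of the test polynomial at correlation parameter `c`. -/
noncomputable def limitCov (L s c : ℝ) : ℝ :=
  ∑ k ∈ Finset.range 3, ∑ l ∈ Finset.range 3, testCoeff L k * testCoeff L l *
    Real.exp (k.choose 2 * s + l.choose 2 * s + k * l * c)

lemma testPoly_eq (L t : ℝ) : testPoly L t = t ^ 2 - L * t - 1 := by
  simp [testPoly, testCoeff, Finset.sum_range_succ]; ring

/-- At `c = 0` the double sum factors as the square of `exp s - L - 1`. -/
lemma limitCov_zero {L s : ℝ} (hs : Real.exp s = L + 1) : limitCov L s 0 = 0 := by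
  simp [limitCov, testCoeff, Finset.sum_range_succ, Real.exp_add, hs]; ring

lemma continuous_limitCov (L s : ℝ) : Continuous (limitCov L s) := by
  unfold limitCov; fun_prop

lemma testPoly_mul_testPoly (L t u : ℝ) : testPoly L t * testPoly L u
    = ∑ k ∈ Finset.range 3, ∑ l ∈ Finset.range 3,
      testCoeff L k * testCoeff L l * (t ^ k * u ^ l) := by
  rw [testPoly, testPoly, Finset.sum_mul_sum]
  exact Finset.sum_congr rfl fun k _ => Finset.sum_congr rfl fun l _ => by ring

lemma integrable_testPoly {X Y : E → ℝ} (hX : Measurable X) (hY : Measurable Y)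
    (hX1 : ∀ x, |X x| ≤ 1) (hY1 : ∀ x, |Y x| ≤ 1) (L a b : ℝ) (n : ℕ) :
    Integrable (fun x => testPoly L (prodOneAdd X a x) * testPoly L (prodOneAdd Y b x))
      (Measure.pi fun _ : Fin n => U) := by
  simp_rw [testPoly_mul_testPoly]
  exact integrable_finsetSum _ fun k _ => integrable_finsetSum _ fun l _ =>
    (integrable_prodOneAdd hX hY hX1 hY1 a b k l n).const_mul _

lemma tendsto_integral_testPoly {X Y : E → ℝ} (hX : Measurable X) (hY : Measurable Y)
    (hX1 : ∀ x, |X x| ≤ 1) (hY1 : ∀ x, |Y x| ≤ 1)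
    (hX0 : ∫ x, X x ∂U = 0) (hY0 : ∫ x, Y x ∂U = 0) {a b : ℕ → ℝ} {A B s : ℝ}
    (ha : Tendsto (fun n : ℕ => √n * a n) atTop (𝓝 A))
    (hb : Tendsto (fun n : ℕ => √n * b n) atTop (𝓝 B))
    (hAs : A ^ 2 * ∫ x, X x ^ 2 ∂U = s) (hBs : B ^ 2 * ∫ x, Y x ^ 2 ∂U = s) (L : ℝ) :
    Tendsto (fun n : ℕ => ∫ x, testPoly L (prodOneAdd X (a n) x) *
        testPoly L (prodOneAdd Y (b n) x) ∂(Measure.pi fun _ : Fin n => U)) atTop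
      (𝓝 (limitCov L s (A * B * ∫ x, X x * Y x ∂U))) := by
  have hint : ∀ n k l, Integrable (fun x => testCoeff L k * testCoeff L l *
      (prodOneAdd X (a n) x ^ k * prodOneAdd Y (b n) x ^ l)) (Measure.pi fun _ : Fin n => U) :=
    fun n k l => (integrable_prodOneAdd hX hY hX1 hY1 (a n) (b n) k l n).const_mul _
  have h : ∀ n : ℕ, ∫ x, testPoly L (prodOneAdd X (a n) x) *
        testPoly L (prodOneAdd Y (b n) x) ∂(Measure.pi fun _ : Fin n => U)
      = ∑ k ∈ Finset.range 3, ∑ l ∈ Finset.range 3, testCoeff L k * testCoeff L l *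
        ∫ x, prodOneAdd X (a n) x ^ k * prodOneAdd Y (b n) x ^ l
          ∂(Measure.pi fun _ : Fin n => U) := by
    intro n
    simp_rw [testPoly_mul_testPoly]
    rw [integral_finsetSum _ fun k _ => integrable_finsetSum _ fun l _ => hint n k l]
    refine Finset.sum_congr rfl fun k _ => ?_
    rw [integral_finsetSum _ fun l _ => hint n k l]
    exact Finset.sum_congr rfl fun l _ => integral_const_mul _ _
  simp_rw [h]
  refine tendsto_finsetSum _ fun k hk => tendsto_finsetSum _ fun l hl => ?_
  have := tendsto_integral_prodOneAdd (U := U) hX hY hX1 hY1 hX0 hY0 ha hb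
    (Finset.mem_range.1 hk) (Finset.mem_range.1 hl)
  rw [hAs, hBs] at this
  exact this.const_mul _

lemma measurable_prodOneAdd {X : E → ℝ} (hX : Measurable X) (a : ℝ) (n : ℕ) :
    Measurable fun x : Fin n → E => prodOneAdd X a x := by
  unfold prodOneAdd; fun_prop

/-- Second moment bound: if finitely many normalized products are nearly uncorrelated, then with
probability close to one some of them exceeds `L`. -/
lemma eventually_measure_forall_le_lt {m : ℕ} {X : Fin m → E → ℝ} (hX : ∀ j, Measurable (X j))
    (hX1 : ∀ j x, |X j x| ≤ 1) (hX0 : ∀ j, ∫ x, X j x ∂U = 0) {a : Fin m → ℕ → ℝ} {A : Fin m → ℝ}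
    {s : ℝ} (ha : ∀ j, Tendsto (fun n : ℕ => √n * a j n) atTop (𝓝 (A j)))
    (hAs : ∀ j, A j ^ 2 * ∫ x, X j x ^ 2 ∂U = s) {L η : ℝ}
    (hη : ∑ j, ∑ k, limitCov L s (A j * A k * ∫ x, X j x * X k x ∂U) < m ^ 2 * η) (hm : 0 < m)
    (hpos : ∀ j, ∀ᶠ n in atTop, ∀ x : Fin n → E, 0 ≤ prodOneAdd (X j) (a j n) x) :
    ∀ᶠ n : ℕ in atTop, (Measure.pi fun _ : Fin n => U).real
      {x | ∀ j, prodOneAdd (X j) (a j n) x ≤ L} < η := by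
  have hlim : Tendsto (fun n : ℕ => ∑ j, ∑ k, ∫ x, testPoly L (prodOneAdd (X j) (a j n) x) *
        testPoly L (prodOneAdd (X k) (a k n) x) ∂(Measure.pi fun _ : Fin n => U)) atTop
      (𝓝 (∑ j, ∑ k, limitCov L s (A j * A k * ∫ x, X j x * X k x ∂U))) :=
    tendsto_finsetSum _ fun j _ => tendsto_finsetSum _ fun k _ =>
      tendsto_integral_testPoly (hX j) (hX k) (hX1 j) (hX1 k) (hX0 j) (hX0 k) (ha j) (ha k)
        (hAs j) (hAs k) L
  filter_upwards [hlim.eventually_lt_const hη, eventually_all.2 hpos] with n hn hposn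
  set P := Measure.pi fun _ : Fin n => U
  set g : Fin m → (Fin n → E) → ℝ := fun j x => testPoly L (prodOneAdd (X j) (a j n) x)
  have hgi : ∀ j k, Integrable (fun x => g j x * g k x) P := fun j k =>
    integrable_testPoly (hX j) (hX k) (hX1 j) (hX1 k) L _ _ n
  have hsq : ∀ x, (∑ j, g j x) ^ 2 = ∑ j, ∑ k, g j x * g k x := fun x => by
    rw [sq, Finset.sum_mul_sum]
  have hint : Integrable (fun x => (∑ j, g j x) ^ 2) P := by
    simp_rw [hsq]
    exact integrable_finsetSum _ fun j _ => integrable_finsetSum _ fun k _ => hgi j k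
  have hval : ∫ x, (∑ j, g j x) ^ 2 ∂P < m ^ 2 * η := by
    simp_rw [hsq]
    rw [integral_finsetSum _ fun j _ => integrable_finsetSum _ fun k _ => hgi j k]
    simp_rw [integral_finsetSum _ fun k _ => hgi _ k]
    exact hn
  -- Markov's inequality for the squared sum, at level `m ^ 2`.
  have hmk := mul_meas_ge_le_integral_of_nonneg (ae_of_all P fun x => sq_nonneg (∑ j, g j x))
    hint ((m : ℝ) ^ 2)
  have hsub : {x | ∀ j, prodOneAdd (X j) (a j n) x ≤ L} ⊆
      {x | (m : ℝ) ^ 2 ≤ (∑ j, g j x) ^ 2} := by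
    intro x hx
    have h1 : ∀ j, g j x ≤ -1 := fun j => by
      simp only [g, testPoly_eq]
      nlinarith [hposn j x, hx j]
    have h2 : ∑ j, g j x ≤ -m := by
      simpa using Finset.sum_le_sum fun (j : Fin m) (_ : j ∈ Finset.univ) => h1 j
    have h3 : (0 : ℝ) ≤ m := m.cast_nonneg
    simp only [Set.mem_ofPred_eq]
    nlinarith
  have hle : P.real {x | ∀ j, prodOneAdd (X j) (a j n) x ≤ L} ≤
      P.real {x | (m : ℝ) ^ 2 ≤ (∑ j, g j x) ^ 2} := measureReal_mono hsub
  have hm2 : (0 : ℝ) < (m : ℝ) ^ 2 := by positivity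
  exact lt_of_mul_lt_mul_left
    (((mul_le_mul_of_nonneg_left hle hm2.le).trans hmk).trans_lt hval) hm2.le

end Moments

/-! ### The centered indicators and their covariances -/

/-- The points of `[0, 1]` at distance at most `p / 2` from the integers. -/
def nearEnds (p : ℝ) : Set ℝ := Set.Iic (p / 2) ∪ Set.Ici (1 - p / 2)

/-- The centered indicator of `nearEnds p`. -/
noncomputable def centeredInd (p x : ℝ) : ℝ := (nearEnds p).indicator 1 x - p

lemma mem_nearEnds {p x : ℝ} : x ∈ nearEnds p ↔ x ≤ p / 2 ∨ 1 - p / 2 ≤ x := Iff.rfl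

/-- The uniform distribution on `[0, 1]`. -/
noncomputable abbrev unif : Measure ℝ := volume.restrict (Set.Icc 0 1)

instance isProbabilityMeasure_unif : IsProbabilityMeasure unif := ⟨by simp⟩

lemma measurableSet_nearEnds (p : ℝ) : MeasurableSet (nearEnds p) :=
  measurableSet_Iic.union measurableSet_Ici

lemma measurable_centeredInd (p : ℝ) : Measurable (centeredInd p) :=
  (measurable_one.indicator (measurableSet_nearEnds p)).sub_const p

lemma abs_centeredInd_le {p : ℝ} (hp : 0 < p) (hp1 : p < 1) (x : ℝ) : |centeredInd p x| ≤ 1 := by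
  unfold centeredInd
  rw [abs_le]
  by_cases h : x ∈ nearEnds p
  · rw [Set.indicator_of_mem h, Pi.one_apply]; constructor <;> linarith
  · rw [Set.indicator_of_notMem h]; constructor <;> linarith

lemma unif_real_nearEnds {p : ℝ} (hp : 0 < p) (hp1 : p < 1) : unif.real (nearEnds p) = p := by
  have h : nearEnds p ∩ Set.Icc 0 1 = Set.Icc 0 (p / 2) ∪ Set.Icc (1 - p / 2) 1 := by
    ext x
    simp only [nearEnds, Set.mem_inter_iff, Set.mem_union, Set.mem_Iic, Set.mem_Ici, Set.mem_Icc]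
    constructor
    · rintro ⟨h | h, h0, h1⟩
      · exact Or.inl ⟨h0, h⟩
      · exact Or.inr ⟨h, h1⟩
    · rintro (⟨h0, h⟩ | ⟨h, h1⟩)
      · exact ⟨Or.inl h, h0, by linarith⟩
      · exact ⟨Or.inr h, by linarith, h1⟩
  have hd : Disjoint (Set.Icc 0 (p / 2)) (Set.Icc (1 - p / 2) 1) := by
    rw [Set.disjoint_left]
    rintro x ⟨-, h⟩ ⟨h', -⟩
    linarith
  rw [measureReal_def, Measure.restrict_apply (measurableSet_nearEnds p), h,
    measure_union hd measurableSet_Icc, Real.volume_Icc, Real.volume_Icc,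
    ← ENNReal.ofReal_add (by linarith) (by linarith), ENNReal.toReal_ofReal (by linarith)]
  ring

lemma integrable_indicator_nearEnds (p : ℝ) :
    Integrable ((nearEnds p).indicator (1 : ℝ → ℝ)) unif :=
  (integrable_const (1 : ℝ)).indicator (measurableSet_nearEnds p)

lemma integral_indicator_nearEnds {p : ℝ} (hp : 0 < p) (hp1 : p < 1) :
    ∫ x, (nearEnds p).indicator (1 : ℝ → ℝ) x ∂unif = p := by
  rw [integral_indicator_one (measurableSet_nearEnds p), unif_real_nearEnds hp hp1]

lemma integral_centeredInd {p : ℝ} (hp : 0 < p) (hp1 : p < 1) :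
    ∫ x, centeredInd p x ∂unif = 0 := by
  unfold centeredInd
  rw [integral_sub (integrable_indicator_nearEnds p) (integrable_const p),
    integral_indicator_nearEnds hp hp1]
  simp

/-- The sets are nested, so the product of the two indicators is that of the smaller set. -/
lemma integral_centeredInd_mul {p q : ℝ} (hp : 0 < p) (hpq : p ≤ q) (hq1 : q < 1) :
    ∫ x, centeredInd p x * centeredInd q x ∂unif = p * (1 - q) := by
  have hsub : nearEnds p ⊆ nearEnds q :=
    Set.union_subset_union (Set.Iic_subset_Iic.2 (by linarith))
      (Set.Ici_subset_Ici.2 (by linarith))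
  have h : ∀ x, centeredInd p x * centeredInd q x =
      (1 - q) * (nearEnds p).indicator 1 x - p * centeredInd q x := by
    intro x
    unfold centeredInd
    by_cases hx : x ∈ nearEnds p
    · simp only [Set.indicator_of_mem hx, Set.indicator_of_mem (hsub hx), Pi.one_apply]; ring
    · simp only [Set.indicator_of_notMem hx]; ring
  have hq : Integrable (centeredInd q) unif :=
    (integrable_indicator_nearEnds q).sub (integrable_const q)
  simp_rw [h]
  rw [integral_sub ((integrable_indicator_nearEnds p).const_mul _) (hq.const_mul _),
    integral_const_mul, integral_const_mul, integral_indicator_nearEnds hp (by linarith),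
    integral_centeredInd (by linarith) hq1]
  ring

/-! ### Lattice points in cubes -/

/-- Integers whose distance to `x` is at most `N + p / 2`. -/
noncomputable def closeInts (p : ℝ) (N : ℕ) (x : ℝ) : Finset ℤ :=
  if x ≤ p / 2 then Finset.Icc (-N) N
  else if 1 - p / 2 ≤ x then Finset.Icc (1 - N) (N + 1) else Finset.Icc (1 - N) N

lemma card_closeInts (p : ℝ) (N : ℕ) (x : ℝ) :
    ((closeInts p N x).card : ℝ) = 2 * N + (nearEnds p).indicator 1 x := by
  have e1 : ((N : ℤ) + 1 - -N).toNat = 2 * N + 1 := by omega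
  have e2 : ((N : ℤ) + 1 + 1 - (1 - N)).toNat = 2 * N + 1 := by omega
  have e3 : ((N : ℤ) + 1 - (1 - N)).toNat = 2 * N := by omega
  unfold closeInts
  split_ifs with h1 h2
  · rw [Set.indicator_of_mem (mem_nearEnds.2 (Or.inl h1)), Int.card_Icc, e1]; simp
  · rw [Set.indicator_of_mem (mem_nearEnds.2 (Or.inr h2)), Int.card_Icc, e2]; simp
  · rw [Set.indicator_of_notMem (mem_nearEnds.not.2 (not_or.2 ⟨h1, h2⟩)), Int.card_Icc, e3]
    simp

/-- Only this inclusion is needed, as lattice points are counted from below. -/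
lemma mem_closeInts {p : ℝ} (hp : 0 < p) {N : ℕ} {x : ℝ} (hx : x ∈ Set.Icc (0 : ℝ) 1) {z : ℤ}
    (hz : z ∈ closeInts p N x) : x - (N + p / 2) ≤ z ∧ (z : ℝ) ≤ x + (N + p / 2) := by
  obtain ⟨h0, h1⟩ := hx
  unfold closeInts at hz
  split_ifs at hz with h2 h3 <;> rw [Finset.mem_Icc] at hz <;> obtain ⟨ha, hb⟩ := hz <;>
    have ha' := (Int.cast_le (R := ℝ)).2 ha <;> have hb' := (Int.cast_le (R := ℝ)).2 hb <;>
    push_cast at ha' hb' <;> constructor <;> linarith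

lemma one_add_centeredInd {p : ℝ} (hp : 0 < p) (N : ℕ) (x : ℝ) :
    1 + (2 * N + p)⁻¹ * centeredInd p x = (closeInts p N x).card / (2 * N + p) := by
  have : (0 : ℝ) < 2 * N + p := by positivity
  rw [card_closeInts, centeredInd]
  field_simp
  ring

lemma prodOneAdd_centeredInd_nonneg {p : ℝ} (hp : 0 < p) (N : ℕ) {n : ℕ} (x : Fin n → ℝ) :
    0 ≤ prodOneAdd (centeredInd p) (2 * N + p)⁻¹ x := by
  refine Finset.prod_nonneg fun i _ => ?_
  rw [one_add_centeredInd hp]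
  positivity

lemma prod_card_closeInts_le {p : ℝ} (hp : 0 < p) (N : ℕ) {n : ℕ} {x : Fin n → ℝ}
    (hx : ∀ i, x i ∈ Set.Icc (0 : ℝ) 1) :
    ((∏ i, (closeInts p N (x i)).card : ℕ) : ℝ≥0∞) ≤ latticeMeasure n (cube x (N + p / 2)) := by
  refine le_trans ?_ (Measure.le_sum_apply _ _)
  refine le_trans ?_ (ENNReal.sum_le_tsum (Fintype.piFinset fun i => closeInts p N (x i)))
  rw [← Fintype.card_piFinset, Finset.cast_card]
  refine Finset.sum_le_sum fun z hz => ?_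
  rw [Measure.dirac_apply_of_mem]
  have h := fun i => mem_closeInts hp (hx i) (Fintype.mem_piFinset.1 hz i)
  exact ⟨fun i => (h i).1, fun i => (h i).2⟩

lemma ofReal_prodOneAdd_le_maximalFunction {p : ℝ} (hp : 0 < p) (N : ℕ) {n : ℕ} {x : Fin n → ℝ}
    (hx : ∀ i, x i ∈ Set.Icc (0 : ℝ) 1) :
    ENNReal.ofReal (prodOneAdd (centeredInd p) (2 * N + p)⁻¹ x) ≤
      maximalFunction (latticeMeasure n) x := by
  have hr : (0 : ℝ) < 2 * N + p := by positivity
  have hvol : volume (cube x (N + p / 2)) = ENNReal.ofReal (∏ _i : Fin n, (2 * N + p)) := by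
    rw [cube, Real.volume_Icc_pi, ENNReal.ofReal_prod_of_nonneg fun _ _ => hr.le]
    congr 1; ext i; congr 1; ring
  refine le_trans ?_ (le_iSup₂_of_le ((N : ℝ) + p / 2) (by positivity) le_rfl)
  unfold prodOneAdd
  simp_rw [one_add_centeredInd hp]
  rw [Finset.prod_div_distrib, hvol, ENNReal.ofReal_div_of_pos (Finset.prod_pos fun _ _ => hr)]
  gcongr
  refine le_trans (le_of_eq ?_) (prod_card_closeInts_le hp N hx)
  rw [← Nat.cast_prod, ENNReal.ofReal_natCast]

/-! ### Choice of the scales -/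

lemma tendsto_sqrt_mul_inv {A : ℝ} (hA : 0 < A) (p : ℝ) :
    Tendsto (fun n : ℕ => √n * (2 * (⌈(2 * A)⁻¹ * √n⌉₊ : ℝ) + p)⁻¹) atTop (𝓝 A) := by
  have hs : Tendsto (fun n : ℕ => √(n : ℝ)) atTop atTop :=
    Real.tendsto_sqrt_atTop.comp tendsto_natCast_atTop_atTop
  have h1 := (tendsto_nat_ceil_mul_div_atTop (inv_nonneg.2 (by positivity : 0 ≤ 2 * A))).comp hs
  have h2 := ((h1.const_mul 2).add ((tendsto_inv_atTop_zero.comp hs).const_mul p)).inv₀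
    (by rw [mul_zero, add_zero]; positivity)
  have e : (2 * (2 * A)⁻¹ + p * 0)⁻¹ = A := by field_simp; ring
  rw [e] at h2
  refine h2.congr fun n => ?_
  simp only [Function.comp_apply]
  rw [← div_eq_mul_inv p, ← mul_div_assoc, ← add_div, inv_div, div_eq_mul_inv]

/-- The limit of `√n` times the reciprocal edge length, normalized so that all ratios have the
same asymptotic log-variance `s`. -/
noncomputable def edgeScale (s p : ℝ) : ℝ := √(s / (p * (1 - p)))

lemma edgeScale_pos {s p : ℝ} (hs : 0 < s) (hp : 0 < p) (hp1 : p < 1) : 0 < edgeScale s p :=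
  Real.sqrt_pos.2 (div_pos hs (mul_pos hp (by linarith)))

lemma edgeScale_sq {s p : ℝ} (hs : 0 < s) (hp : 0 < p) (hp1 : p < 1) :
    edgeScale s p ^ 2 = s / (p * (1 - p)) :=
  Real.sq_sqrt (div_pos hs (mul_pos hp (by linarith))).le

lemma edgeScale_sq_mul_integral {s p : ℝ} (hs : 0 < s) (hp : 0 < p) (hp1 : p < 1) :
    edgeScale s p ^ 2 * ∫ x, centeredInd p x ^ 2 ∂unif = s := by
  simp_rw [sq (centeredInd p _)]
  rw [integral_centeredInd_mul hp le_rfl hp1, edgeScale_sq hs hp hp1]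
  have : 1 - p ≠ 0 := by linarith
  field_simp

/-- The square equals `s ^ 2 * (p / q) * ((1 - q) / (1 - p))`; squaring removes the roots in
`edgeScale`. -/
lemma sq_correlation_le {s p q θ : ℝ} (hs : 0 < s) (hp : 0 < p) (hpq : p ≤ q) (hq1 : q < 1)
    (hθ : p ≤ θ * q) :
    (edgeScale s p * edgeScale s q * ∫ x, centeredInd p x * centeredInd q x ∂unif) ^ 2
      ≤ s ^ 2 * θ := by
  have hq : 0 < q := by linarith
  have h1 : 0 < 1 - q := by linarith
  have h2 : 0 < 1 - p := by linarith
  rw [integral_centeredInd_mul hp hpq hq1, mul_pow, mul_pow, edgeScale_sq hs hp (by linarith),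
    edgeScale_sq hs hq hq1]
  have e : s / (p * (1 - p)) * (s / (q * (1 - q))) * (p * (1 - q)) ^ 2 =
      s ^ 2 * ((p / q) * ((1 - q) / (1 - p))) := by field_simp
  have h3 : p / q ≤ θ := (div_le_iff₀ hq).2 hθ
  have h4 : (1 - q) / (1 - p) ≤ 1 := (div_le_one h2).2 (by linarith)
  rw [e]
  gcongr
  exact (mul_le_of_le_one_right (by positivity) h4).trans h3

lemma abs_correlation_lt {s θ δ : ℝ} (hs : 0 < s) (hθ0 : 0 < θ) (hθ1 : θ < 1) (hδ : 0 < δ)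
    (h : s ^ 2 * θ < δ ^ 2) {j k : ℕ} (hjk : j ≠ k) :
    |edgeScale s (θ ^ (j + 1)) * edgeScale s (θ ^ (k + 1)) *
      ∫ x, centeredInd (θ ^ (j + 1)) x * centeredInd (θ ^ (k + 1)) x ∂unif| < δ := by
  wlog hlt : k < j generalizing j k
  · have := this hjk.symm (by omega)
    simpa only [mul_comm] using this
  have hle : θ ^ (j + 1) ≤ θ * θ ^ (k + 1) := by
    rw [← pow_succ']
    exact pow_le_pow_of_le_one hθ0.le hθ1.le (by omega)
  refine abs_lt_of_sq_lt_sq (lt_of_le_of_lt (sq_correlation_le hs (by positivity)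
    (pow_le_pow_of_le_one hθ0.le hθ1.le (by omega)) (pow_lt_one₀ hθ0.le hθ1 (by omega)) hle) h)
    hδ.le

lemma exists_scales {L η : ℝ} (hL : 0 < L) (hη : 0 < η) :
    ∃ (m : ℕ) (p : Fin m → ℝ) (N : Fin m → ℕ → ℕ), (∀ j, 0 < p j) ∧
      ∀ᶠ n : ℕ in atTop, (Measure.pi fun _ : Fin n => unif).real
        {x | ∀ j, prodOneAdd (centeredInd (p j)) (2 * N j n + p j)⁻¹ x ≤ L} < η := by
  set s := Real.log (L + 1)
  have hs : 0 < s := Real.log_pos (by linarith)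
  have hexp : Real.exp s = L + 1 := Real.exp_log (by linarith)
  -- The `m` diagonal terms then total less than `m ^ 2 * η / 2`, leaving `η / 2` for each
  -- off-diagonal one.
  obtain ⟨m, hm⟩ := exists_nat_gt (2 * |limitCov L s s| / η)
  have hm0 : (0 : ℝ) < m := lt_of_le_of_lt (by positivity) hm
  obtain ⟨δ, hδ, hδF⟩ := Metric.continuousAt_iff.1 ((continuous_limitCov L s).continuousAt (x := 0))
    (η / 2) (half_pos hη)
  simp only [Real.dist_eq, limitCov_zero hexp, sub_zero] at hδF
  -- The first bound gives `θ < 1`; the second puts correlations below `δ`.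
  set θ := min (1 / 2) (δ ^ 2 / (2 * s ^ 2))
  have hθ0 : 0 < θ := by positivity
  have hθ1 : θ < 1 := (min_le_left _ _).trans_lt (by norm_num)
  have hθ : s ^ 2 * θ < δ ^ 2 := by
    calc s ^ 2 * θ ≤ s ^ 2 * (δ ^ 2 / (2 * s ^ 2)) := by gcongr; exact min_le_right _ _
      _ = δ ^ 2 / 2 := by field_simp
      _ < δ ^ 2 := half_lt_self (by positivity)
  have hp0 : ∀ j : Fin m, 0 < θ ^ ((j : ℕ) + 1) := fun j => by positivity
  have hp1 : ∀ j : Fin m, θ ^ ((j : ℕ) + 1) < 1 := fun j => pow_lt_one₀ hθ0.le hθ1 (by omega)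
  refine ⟨m, fun j => θ ^ ((j : ℕ) + 1),
    fun j n => ⌈(2 * edgeScale s (θ ^ ((j : ℕ) + 1)))⁻¹ * √n⌉₊, hp0, ?_⟩
  refine eventually_measure_forall_le_lt (fun j => measurable_centeredInd _)
    (fun j => abs_centeredInd_le (hp0 j) (hp1 j)) (fun j => integral_centeredInd (hp0 j) (hp1 j))
    (A := fun j => edgeScale s (θ ^ ((j : ℕ) + 1)))
    (fun j => tendsto_sqrt_mul_inv (edgeScale_pos hs (hp0 j) (hp1 j)) _)
    (fun j => edgeScale_sq_mul_integral hs (hp0 j) (hp1 j)) ?_ (by exact_mod_cast hm0)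
    (fun j => Eventually.of_forall fun n x => prodOneAdd_centeredInd_nonneg (hp0 j) _ x)
  have hterm : ∀ j k : Fin m, limitCov L s (edgeScale s (θ ^ ((j : ℕ) + 1)) *
      edgeScale s (θ ^ ((k : ℕ) + 1)) *
      ∫ x, centeredInd (θ ^ ((j : ℕ) + 1)) x * centeredInd (θ ^ ((k : ℕ) + 1)) x ∂unif)
      ≤ (if j = k then |limitCov L s s| else 0) + η / 2 := by
    intro j k
    split_ifs with hjk
    · subst hjk
      have h := edgeScale_sq_mul_integral hs (hp0 j) (hp1 j)
      simp_rw [sq] at h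
      rw [h]
      linarith [le_abs_self (limitCov L s s)]
    · rw [zero_add]
      exact (le_abs_self _).trans
        (hδF (abs_correlation_lt hs hθ0 hθ1 hδ hθ fun h => hjk (Fin.ext h))).le
  refine (Finset.sum_le_sum fun j _ => Finset.sum_le_sum fun k _ => hterm j k).trans_lt ?_
  simp only [Finset.sum_add_distrib, Finset.sum_ite_eq, Finset.mem_univ, if_true,
    Finset.sum_const, Finset.card_univ, Fintype.card_fin, nsmul_eq_mul]
  rw [div_lt_iff₀ hη] at hm
  nlinarith

/-! ### Conclusion -/

lemma volume_inter_unitCube {n : ℕ} {T : Set (Fin n → ℝ)} (hT : MeasurableSet T) :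
    volume (T ∩ Set.univ.pi fun _ => Set.Icc (0 : ℝ) 1) =
      (Measure.pi fun _ : Fin n => unif) T := by
  rw [← Measure.restrict_pi_pi, Measure.restrict_apply hT, volume_pi]

theorem theorem2 (L : ℝ) (hL : 0 < L) :
    Tendsto
      (fun n : ℕ =>
        volume {x : Fin n → ℝ |
          (∀ i, x i ∈ Set.Icc (0 : ℝ) 1) ∧
            ENNReal.ofReal L < maximalFunction (latticeMeasure n) x})
      atTop (𝓝 1) := by
  refine tendsto_order.2 ⟨fun a ha => ?_, fun a ha => Eventually.of_forall fun n => ?_⟩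
  · have ha' : a.toReal < 1 := by
      rw [← ENNReal.toReal_one]
      exact (ENNReal.toReal_lt_toReal ha.ne_top ENNReal.one_ne_top).2 ha
    obtain ⟨m, p, N, hp, hev⟩ := exists_scales hL (sub_pos.2 ha')
    filter_upwards [hev] with n hn
    set bad := {x : Fin n → ℝ | ∀ j, prodOneAdd (centeredInd (p j)) (2 * N j n + p j)⁻¹ x ≤ L}
      with hbad
    have hmeas : MeasurableSet bad := by
      rw [hbad, Set.ofPred_forall]
      exact MeasurableSet.iInter fun j =>
        measurableSet_le (measurable_prodOneAdd (measurable_centeredInd _) _ _) measurable_const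
    have hlt : a < (Measure.pi fun _ : Fin n => unif) badᶜ := by
      rw [← ENNReal.toReal_lt_toReal ha.ne_top (measure_ne_top _ _)]
      change _ < (Measure.pi fun _ : Fin n => unif).real badᶜ
      rw [probReal_compl_eq_one_sub hmeas]
      linarith
    rw [← volume_inter_unitCube hmeas.compl] at hlt
    -- Monotonicity suffices, so the superlevel set of the maximal function need not be shown
    -- measurable.
    refine hlt.trans_le (measure_mono fun x hx => ?_)
    have hx1 : ∀ i, x i ∈ Set.Icc (0 : ℝ) 1 := fun i => hx.2 i (Set.mem_univ i)
    have hx2 : ¬ ∀ j, prodOneAdd (centeredInd (p j)) (2 * N j n + p j)⁻¹ x ≤ L := hx.1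
    push Not at hx2
    obtain ⟨j, hj⟩ := hx2
    exact ⟨hx1, ((ENNReal.ofReal_lt_ofReal_iff (hL.trans hj)).2 hj).trans_le
      (ofReal_prodOneAdd_le_maximalFunction (hp j) _ hx1)⟩
  · refine lt_of_le_of_lt ?_ ha
    calc _ ≤ volume (Set.univ ∩ Set.univ.pi fun _ : Fin n => Set.Icc (0 : ℝ) 1) :=
          measure_mono fun x hx => ⟨Set.mem_univ x, fun i _ => hx.1 i⟩
      _ = 1 := by rw [volume_inter_unitCube MeasurableSet.univ, measure_univ]
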